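/- Let $q$ be a complex number with $|q|<1$. Write $(a;q)_n=\prod_{k=0}^{n-1}(1-aq^k)$ and $(a;q)_\infty=\prod_{k=0}^{\infty}(1-aq^k)$, and put $$\psi(q)=\sum_{n=0}^{\infty}q^{n(n+1)/2},\qquad f_a(q)=\sum_{n=0}^{\infty}\frac{q^{n^2}}{\prod_{k=1}^{n}(1+aq^k+q^{2k})}\quad(a\in\mathbb{R}),\qquad \tilde\phi(q)=f_0(q)=\sum_{n=0}^{\infty}\frac{q^{n^2}}{(-q^2;q^2)_n},$$ where $\tilde\phi$ is one of Ramanujan's third order mock theta functions. Then all the series and infinite products in the following identity converge, and $$\frac12\left(1+e^{\pi i/4}\right)\tilde\phi(iq)+\frac12\left(1+e^{-\pi i/4}\right)\tilde\phi(-iq)-f_{\sqrt2}(q)=\frac{1}{\sqrt2}\,\psi(-q)\,(-q^2;q^4)_\infty\prod_{n=1}^{\infty}\frac{1}{1+\sqrt2\,q^n+q^{2n}}.$$ -/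

import Mathlib

namespace MockTheta

/-- The finite `q`-shifted factorial `(a; q)_n = ∏_{k=0}^{n-1} (1 - a q^k)`. -/
noncomputable def qPoch (a q : ℂ) (n : ℕ) : ℂ := ∏ k ∈ Finset.range n, (1 - a * q ^ k)

/-- The infinite `q`-shifted factorial `(a; q)_∞ = ∏_{k=0}^∞ (1 - a q^k)`. -/
noncomputable def qPochInf (a q : ℂ) : ℂ := ∏' k : ℕ, (1 - a * q ^ k)

/-- The theta function `ψ(q) = ∑_{n=0}^∞ q^{n(n+1)/2}`. -/
noncomputable def psi (q : ℂ) : ℂ := ∑' n : ℕ, q ^ ((n + 1).choose 2)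

/-- The `n`-th term of `f_a(q)`, namely `q^{n^2} / ∏_{k=1}^n (1 + a q^k + q^{2k})`. -/
noncomputable def fTerm (a : ℝ) (q : ℂ) (n : ℕ) : ℂ :=
  q ^ (n ^ 2) / ∏ k ∈ Finset.Icc 1 n, (1 + (a : ℂ) * q ^ k + q ^ (2 * k))

/-- `f_a(q) = ∑_{n=0}^∞ q^{n^2} / ((1 + a q + q^2)(1 + a q^2 + q^4) ⋯ (1 + a q^n + q^{2n}))`. -/
noncomputable def f (a : ℝ) (q : ℂ) : ℂ := ∑' n : ℕ, fTerm a q n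

/-- The `n`-th term of the third order mock theta function `φ̃(q)`,
namely `q^{n^2} / (-q^2; q^2)_n`. -/
noncomputable def phiTerm (q : ℂ) (n : ℕ) : ℂ := q ^ (n ^ 2) / qPoch (-q ^ 2) (q ^ 2) n

/-- The third order mock theta function `φ̃(q) = ∑_{n=0}^∞ q^{n^2} / (-q^2; q^2)_n`. -/
noncomputable def phi (q : ℂ) : ℂ := ∑' n : ℕ, phiTerm q n

/-- The third order mock theta function `φ̃` is the case `a = 0` of `f_a`. -/
theorem phi_eq_f_zero (q : ℂ) : phi q = f 0 q := by
  unfold phi f phiTerm fTerm qPoch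
  congr 1
  funext n
  congr 1
  rw [← Finset.Ico_add_one_right_eq_Icc, Finset.prod_Ico_eq_prod_range]
  refine Finset.prod_congr (by simp) fun k _ => ?_
  push_cast
  ring

end MockTheta

/-!
For `|w| = 1` the series `f_a(q)` with `a = -(w + 1/w)` is the value at `z = w` of the rank
generating function `G(z; q) = ∑ q^{n²} / ((zq; q)_n (q/z; q)_n)`; in particular `φ̃(q) = G(i; q)`,
and `f_{√2}(q) = G(c i; q)` with `c = e^{πi/4}`. The identity is obtained by inserting a free
variable `z` and using that an elliptic function without poles is constant.

Put `g(z; q) = G(z; q) / (1 - z)`. It satisfies `g(qz; q) = 1 - q z² - q z³ g(z; q)`, which comes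
from a telescoping recurrence for a two-variable version of `G` (`durfeeSum_eq_add`,
`clearedRank_mul`). Iterating it, to the base `q` for `g(cz; q)` and to the bases `±iq` for
`g(±z; ±iq)`, where `(±iq)² = -q²`, one finds that in
`M(z) = g(cz; q) + (ic/2) (g(z; iq) - g(-z; iq)) - (1/2) (g(z; -iq) + g(-z; -iq))`
the inhomogeneous terms cancel, so that `M(q²z) = -i q⁵ z⁶ M(z)` (`rankCombination_sq_mul`). All
poles of `M` are simple and lie among the zeros of `θ(cz; q) θ(z²; -q²)`. Multiplying by this
product gives a function `N`, holomorphic for `z ≠ 0`, with `N(q²z) = q² N(z)`. Hence `N(z) / z` is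
constant (`eq_of_forall_mul_eq`). The constant is read off at `z = 1/c`, where Cauchy's identity
`∑ q^{n²} / (q; q)_n² = 1 / (q; q)_∞` (`durfeeSum_one_one`) is all that is needed
(`rankCombination_eq`).

At `z = i` the function `M` is a combination of `f_{√2}(q)`, `φ̃(iq)` and `φ̃(-iq)`, and the identity
results once the quotient of infinite products on the other side is recognised as
`ψ(-q) (-q²; q⁴)_∞`. This uses Gauss's product for `ψ` (`psi_eq`), proved as the limit of a
telescoping finite identity of Shanks. To avoid division by zero, all functions of `z` are handled
with their denominators cleared. The case `q = 0`, where there is no annulus to work on, is checked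
directly.
-/

namespace MockTheta

open Filter Topology Complex

/-! ### Infinite `q`-shifted factorials -/

section qPochInf

variable {q : ℂ}

lemma summable_norm_neg_mul_pow (hq : ‖q‖ < 1) (a : ℂ) :
    Summable fun k : ℕ => ‖-(a * q ^ k)‖ := by
  simpa [norm_mul, norm_pow] using
    (summable_geometric_of_lt_one (norm_nonneg q) hq).mul_left ‖a‖

lemma multipliable_qPochInf (hq : ‖q‖ < 1) (a : ℂ) :
    Multipliable fun k : ℕ => 1 - a * q ^ k := by
  simpa [sub_eq_add_neg] using multipliable_one_add_of_summable (summable_norm_neg_mul_pow hq a)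

lemma qPochInf_zero (q : ℂ) : qPochInf 0 q = 1 := by simp [qPochInf]

lemma qPochInf_ne_zero (hq : ‖q‖ < 1) {a : ℂ} (ha : ∀ k : ℕ, a * q ^ k ≠ 1) :
    qPochInf a q ≠ 0 := by
  have h := tprod_one_add_ne_zero_of_summable (f := fun k : ℕ => -(a * q ^ k))
    (fun k => by rw [← sub_eq_add_neg, sub_ne_zero]; exact (ha k).symm)
    (summable_norm_neg_mul_pow hq a)
  simpa [qPochInf, sub_eq_add_neg] using h

lemma mul_pow_succ_ne_one (hq : ‖q‖ < 1) {a : ℂ} (ha : ‖a‖ ≤ 1) (k : ℕ) :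
    a * q * q ^ k ≠ 1 := by
  intro h
  have h1 : ‖a‖ * ‖q‖ ^ (k + 1) = 1 := by
    rw [← norm_pow, ← norm_mul, pow_succ', ← mul_assoc, h, norm_one]
  have h2 : ‖q‖ ^ (k + 1) < 1 := pow_lt_one₀ (norm_nonneg q) hq (by omega)
  nlinarith [norm_nonneg a, pow_nonneg (norm_nonneg q) (k + 1)]

lemma qPochInf_mul_ne_zero (hq : ‖q‖ < 1) {a : ℂ} (ha : ‖a‖ ≤ 1) : qPochInf (a * q) q ≠ 0 :=
  qPochInf_ne_zero hq (mul_pow_succ_ne_one hq ha)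

/-- `(a; q)_∞ = (a; q)_n (a q^n; q)_∞`. -/
lemma qPoch_mul_qPochInf (hq : ‖q‖ < 1) (a : ℂ) (n : ℕ) :
    qPoch a q n * qPochInf (a * q ^ n) q = qPochInf a q := by
  have h := multipliable_qPochInf hq (a * q ^ n)
  have h' : Multipliable fun k : ℕ => 1 - a * q ^ (k + n) := by
    refine h.congr fun k => ?_
    ring
  have hshift : qPochInf (a * q ^ n) q = ∏' k : ℕ, (1 - a * q ^ (k + n)) :=
    tprod_congr fun k => by ring
  rw [hshift]
  exact Multipliable.prod_mul_tprod_nat_mul' (f := fun k : ℕ => 1 - a * q ^ k) h'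

lemma one_sub_mul_qPochInf (hq : ‖q‖ < 1) (a : ℂ) :
    (1 - a) * qPochInf (a * q) q = qPochInf a q := by
  simpa [qPoch] using qPoch_mul_qPochInf hq a 1

lemma qPochInf_one (hq : ‖q‖ < 1) : qPochInf 1 q = 0 := by
  rw [← one_sub_mul_qPochInf hq]; simp

/-- `(a; q)_∞ (-a; q)_∞ = (a²; q²)_∞`. -/
lemma qPochInf_mul_qPochInf_neg (hq : ‖q‖ < 1) (a : ℂ) :
    qPochInf a q * qPochInf (-a) q = qPochInf (a ^ 2) (q ^ 2) := by
  rw [qPochInf, qPochInf, qPochInf,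
    ← (multipliable_qPochInf hq a).tprod_mul (multipliable_qPochInf hq (-a))]
  exact tprod_congr fun k => by ring

lemma norm_sq_lt_one (hq : ‖q‖ < 1) : ‖q ^ 2‖ < 1 := by
  rw [norm_pow]; exact pow_lt_one₀ (norm_nonneg q) hq two_ne_zero

/-- `(a; q²)_∞ (a q; q²)_∞ = (a; q)_∞`. -/
lemma qPochInf_even_mul_odd (hq : ‖q‖ < 1) (a : ℂ) :
    qPochInf a (q ^ 2) * qPochInf (a * q) (q ^ 2) = qPochInf a q := by
  have h2 := norm_sq_lt_one hq
  have he := multipliable_qPochInf h2 a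
  have ho := multipliable_qPochInf h2 (a * q)
  have he' : Multipliable fun k : ℕ => 1 - a * q ^ (2 * k) := he.congr fun k => by ring
  have ho' : Multipliable fun k : ℕ => 1 - a * q ^ (2 * k + 1) := ho.congr fun k => by ring
  have hE : qPochInf a (q ^ 2) = ∏' k : ℕ, (1 - a * q ^ (2 * k)) :=
    tprod_congr fun k => by ring
  have hO : qPochInf (a * q) (q ^ 2) = ∏' k : ℕ, (1 - a * q ^ (2 * k + 1)) :=
    tprod_congr fun k => by ring
  rw [hE, hO]
  exact tprod_even_mul_odd (f := fun k : ℕ => 1 - a * q ^ k) he' ho'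

lemma norm_qPochInf_le (hq : ‖q‖ < 1) (a : ℂ) :
    ‖qPochInf a q‖ ≤ Real.exp (‖a‖ / (1 - ‖q‖)) := by
  have h := (multipliable_qPochInf hq a).hasProd.tendsto_prod_nat.norm
  refine le_of_tendsto' h fun n => ?_
  rw [norm_prod]
  calc ∏ k ∈ Finset.range n, ‖1 - a * q ^ k‖
      ≤ ∏ k ∈ Finset.range n, (1 + ‖a‖ * ‖q‖ ^ k) := by
        refine Finset.prod_le_prod (fun _ _ => norm_nonneg _) fun k _ => ?_
        simpa [norm_mul, norm_pow] using norm_sub_le (1 : ℂ) (a * q ^ k)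
    _ ≤ Real.exp (∑ k ∈ Finset.range n, ‖a‖ * ‖q‖ ^ k) :=
        Real.prod_one_add_le_exp_sum _ fun k => by positivity
    _ ≤ Real.exp (‖a‖ / (1 - ‖q‖)) := by
        refine Real.exp_le_exp.mpr ?_
        rw [← Finset.mul_sum, div_eq_mul_inv, ← tsum_geometric_of_lt_one (norm_nonneg q) hq]
        exact mul_le_mul_of_nonneg_left
          ((summable_geometric_of_lt_one (norm_nonneg q) hq).sum_le_tsum _
            fun _ _ => by positivity) (norm_nonneg a)

lemma norm_qPochInf_mul_pow_le (hq : ‖q‖ < 1) (a : ℂ) (n : ℕ) :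
    ‖qPochInf (a * q ^ n) q‖ ≤ Real.exp (‖a‖ / (1 - ‖q‖)) := by
  refine (norm_qPochInf_le hq _).trans (Real.exp_le_exp.mpr ?_)
  have : 0 < 1 - ‖q‖ := by linarith
  gcongr
  rw [norm_mul, norm_pow]
  exact mul_le_of_le_one_right (norm_nonneg a) (pow_le_one₀ (norm_nonneg q) hq.le)

lemma differentiable_qPochInf (hq : ‖q‖ < 1) : Differentiable ℂ fun a => qPochInf a q := by
  have key : ∀ R : ℝ, DifferentiableOn ℂ (fun a => qPochInf a q) (Metric.ball 0 R) := fun R => by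
    have hb : ∀ (k : ℕ), ∀ a ∈ Metric.ball (0 : ℂ) R, ‖-(a * q ^ k)‖ ≤ R * ‖q‖ ^ k := by
      intro k a ha
      rw [mem_ball_zero_iff] at ha
      rw [norm_neg, norm_mul, norm_pow]
      gcongr
    have hprod : HasProdLocallyUniformlyOn (fun (k : ℕ) (a : ℂ) => 1 + -(a * q ^ k))
        (fun a => ∏' k : ℕ, (1 + -(a * q ^ k))) (Metric.ball 0 R) :=
      ((summable_geometric_of_lt_one (norm_nonneg q) hq).mul_left
        R).hasProdLocallyUniformlyOn_nat_one_add Metric.isOpen_ball (.of_forall hb)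
        (fun k => by fun_prop)
    have h := hprod.differentiableOn (.of_forall fun s => by
      simpa [Finset.prod_fn] using DifferentiableOn.finsetProd (fun _ _ => by fun_prop))
      Metric.isOpen_ball
    simpa [qPochInf, sub_eq_add_neg] using h
  intro a
  exact (key (‖a‖ + 1)).differentiableAt (Metric.isOpen_ball.mem_nhds (by simp))

end qPochInf

/-! ### A two-variable Durfee-square sum -/

section durfeeSum

variable {q : ℂ}

/-- The `n`-th term of `durfeeSum`. -/
noncomputable def durfeeTerm (b t q : ℂ) (n : ℕ) : ℂ :=
  (b * t) ^ n * q ^ (n ^ 2) * (qPochInf (b * q ^ (n + 1)) q * qPochInf (t * q ^ (n + 1)) q)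

/-- The entire function
`∑ (bt)^n q^{n²} (b q^{n+1}; q)_∞ (t q^{n+1}; q)_∞` of `b` and `t`, that is
`(bq; q)_∞ (tq; q)_∞ ∑ (bt)^n q^{n²} / ((bq; q)_n (tq; q)_n)` with its denominators cleared. -/
noncomputable def durfeeSum (b t q : ℂ) : ℂ := ∑' n : ℕ, durfeeTerm b t q n

lemma summable_pow_mul_pow_sq {r : ℝ} (hr0 : 0 ≤ r) (hr : r < 1) (x : ℝ) :
    Summable fun n : ℕ => x ^ n * r ^ (n ^ 2) := by
  refine summable_of_ratio_norm_eventually_le (r := 1 / 2) (by norm_num) ?_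
  have h0 : Tendsto (fun n : ℕ => |x| * r ^ (2 * n + 1)) atTop (𝓝 0) := by
    have h1 := (tendsto_pow_atTop_nhds_zero_of_lt_one hr0 hr).comp
      (tendsto_atTop_mono (fun n => by simp; omega) tendsto_id :
        Tendsto (fun n : ℕ => 2 * n + 1) atTop atTop)
    simpa using h1.const_mul |x|
  filter_upwards [h0.eventually_le_const (show (0 : ℝ) < 1 / 2 by norm_num)] with n hn
  have : x ^ (n + 1) * r ^ ((n + 1) ^ 2) = (x * r ^ (2 * n + 1)) * (x ^ n * r ^ (n ^ 2)) := by
    ring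
  rw [this, norm_mul]
  refine mul_le_mul_of_nonneg_right ?_ (norm_nonneg _)
  rwa [norm_mul, norm_pow, Real.norm_eq_abs, Real.norm_of_nonneg hr0]

lemma norm_durfeeTerm_le (hq : ‖q‖ < 1) {b t : ℂ} {x R : ℝ} (hbt : ‖b * t‖ ≤ x) (hb : ‖b‖ ≤ R)
    (ht : ‖t‖ ≤ R) (n : ℕ) :
    ‖durfeeTerm b t q n‖ ≤ x ^ n * ‖q‖ ^ (n ^ 2) * Real.exp (R / (1 - ‖q‖)) ^ 2 := by
  have h1 : 0 < 1 - ‖q‖ := by linarith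
  have hb' := (norm_qPochInf_mul_pow_le hq b (n + 1)).trans
    (Real.exp_le_exp.mpr (div_le_div_of_nonneg_right hb h1.le))
  have ht' := (norm_qPochInf_mul_pow_le hq t (n + 1)).trans
    (Real.exp_le_exp.mpr (div_le_div_of_nonneg_right ht h1.le))
  have hx : 0 ≤ x := (norm_nonneg _).trans hbt
  rw [durfeeTerm, norm_mul, norm_mul, norm_mul _ (qPochInf _ _), norm_pow, norm_pow, sq (Real.exp _)]
  gcongr

lemma summable_durfeeTerm (hq : ‖q‖ < 1) (b t : ℂ) : Summable (durfeeTerm b t q) :=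
  .of_norm_bounded ((summable_pow_mul_pow_sq (norm_nonneg q) hq ‖b * t‖).mul_right _)
    (norm_durfeeTerm_le hq le_rfl (le_max_left ‖b‖ ‖t‖) (le_max_right _ _))

lemma durfeeSum_comm (b t q : ℂ) : durfeeSum b t q = durfeeSum t b q :=
  tsum_congr fun n => by simp only [durfeeTerm]; ring

/-- The first-order recurrence in `t`. The difference of the two sums telescopes, with
`-(bt)^n q^{n²} (b q^n; q)_∞ (t q^{n+1}; q)_∞` as its antidifference. -/
lemma durfeeSum_eq_add (hq : ‖q‖ < 1) (b t : ℂ) :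
    durfeeSum b t q = qPochInf b q * qPochInf (t * q) q + b * durfeeSum b (t * q) q := by
  set g : ℕ → ℂ := fun n =>
    (b * t) ^ n * q ^ (n ^ 2) * (qPochInf (b * q ^ n) q * qPochInf (t * q ^ (n + 1)) q) with hg
  have hgs : Summable g := by
    refine .of_norm_bounded (((summable_pow_mul_pow_sq (norm_nonneg q) hq ‖b * t‖).mul_right
      (Real.exp (‖b‖ / (1 - ‖q‖)) * Real.exp (‖t‖ / (1 - ‖q‖))))) fun n => ?_
    rw [hg, norm_mul, norm_mul, norm_mul _ (qPochInf _ _), norm_pow, norm_pow]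
    gcongr
    · exact norm_qPochInf_mul_pow_le hq b n
    · exact norm_qPochInf_mul_pow_le hq t (n + 1)
  have hterm : ∀ n, durfeeTerm b t q n - b * durfeeTerm b (t * q) q n = g n - g (n + 1) := by
    intro n
    have e1 : qPochInf (b * q ^ n) q = (1 - b * q ^ n) * qPochInf (b * q ^ (n + 1)) q := by
      rw [← one_sub_mul_qPochInf hq (b * q ^ n), pow_succ, mul_assoc]
    have e2 : qPochInf (t * q ^ (n + 1)) q
        = (1 - t * q ^ (n + 1)) * qPochInf (t * q ^ (n + 2)) q := by
      rw [← one_sub_mul_qPochInf hq (t * q ^ (n + 1)), pow_succ q (n + 1), mul_assoc t]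
    have e3 : t * q * q ^ (n + 1) = t * q ^ (n + 2) := by ring
    simp only [durfeeTerm, hg, e3, e1, e2, show n + 1 + 1 = n + 2 from rfl]
    ring
  have h1 := (summable_durfeeTerm hq b t).tsum_sub
    ((summable_durfeeTerm hq b (t * q)).mul_left b)
  have h2 := hgs.tsum_sub ((summable_nat_add_iff 1).mpr hgs)
  have h3 := hgs.tsum_eq_zero_add
  rw [tsum_congr hterm, h2, h3, tsum_mul_left] at h1
  have h4 : g 0 = qPochInf b q * qPochInf (t * q) q := by simp [hg]
  rw [durfeeSum, durfeeSum, ← h4]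
  linear_combination -h1

/-- Cauchy's identity `∑ q^{n²} / (q; q)_n² = 1 / (q; q)_∞`, in cleared form: for `b = 1` the sum
is invariant under `t ↦ t q`, hence it equals its value at `t = 0`. -/
lemma durfeeSum_one_one (hq : ‖q‖ < 1) : durfeeSum 1 1 q = qPochInf q q := by
  have hstep : ∀ n : ℕ, durfeeSum 1 (q ^ n) q = durfeeSum 1 1 q := by
    intro n
    induction n with
    | zero => simp
    | succ n ih =>
      rw [← ih, durfeeSum_eq_add hq 1 (q ^ n), qPochInf_one hq, pow_succ]; ring
  have hlim : Tendsto (fun n : ℕ => durfeeSum 1 (q ^ n) q) atTop (𝓝 (durfeeSum 1 0 q)) := by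
    refine tendsto_tsum_of_dominated_convergence
      ((summable_pow_mul_pow_sq (norm_nonneg q) hq 1).mul_right _) (fun k => ?_)
      (.of_forall fun n => norm_durfeeTerm_le hq (x := 1) (R := 1) ?_ (by simp) ?_)
    · have hc : Continuous fun t : ℂ => durfeeTerm 1 t q k := by
        have := (differentiable_qPochInf hq).continuous
        unfold durfeeTerm
        fun_prop
      exact (hc.tendsto 0).comp (tendsto_pow_atTop_nhds_zero_of_norm_lt_one hq)
    · simpa [norm_pow] using pow_le_one₀ (norm_nonneg q) hq.le
    · simpa [norm_pow] using pow_le_one₀ (norm_nonneg q) hq.le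
  have h0 : durfeeSum 1 0 q = qPochInf q q := by
    rw [durfeeSum, tsum_eq_single 0 fun n hn => by simp [durfeeTerm, hn]]
    simp [durfeeTerm, qPochInf_zero]
  rw [← h0]
  exact tendsto_nhds_unique (by simp [hstep]) hlim

end durfeeSum

/-! ### Theta products and the rank generating function under `z ↦ q z` -/

section theta

variable {q z : ℂ}

/-- The theta product `(z; q)_∞ (q / z; q)_∞`. -/
noncomputable def thetaProd (z q : ℂ) : ℂ := qPochInf z q * qPochInf (q / z) q

/-- The rank generating function `∑ q^{n²} / ((zq; q)_n (q/z; q)_n)` multiplied by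
`(zq; q)_∞ (q/z; q)_∞`, which makes it holomorphic on `z ≠ 0`. -/
noncomputable def clearedRank (z q : ℂ) : ℂ := durfeeSum z z⁻¹ q

lemma thetaProd_eq (hq : ‖q‖ < 1) (z : ℂ) :
    thetaProd z q = (1 - z) * (qPochInf (z * q) q * qPochInf (z⁻¹ * q) q) := by
  rw [thetaProd, ← one_sub_mul_qPochInf hq z, div_eq_inv_mul, mul_assoc]

lemma thetaProd_one (hq : ‖q‖ < 1) : thetaProd 1 q = 0 := by simp [thetaProd_eq hq]

/-- `θ(z; q) θ(-z; q) = θ(z²; q²)`. -/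
lemma thetaProd_mul_neg (hq : ‖q‖ < 1) (z : ℂ) :
    thetaProd z q * thetaProd (-z) q = thetaProd (z ^ 2) (q ^ 2) := by
  rw [thetaProd, thetaProd, thetaProd, ← qPochInf_mul_qPochInf_neg hq, ← div_pow,
    ← qPochInf_mul_qPochInf_neg hq, div_neg]
  ring

lemma thetaProd_mul (hq : ‖q‖ < 1) (hq0 : q ≠ 0) (hz : z ≠ 0) :
    thetaProd (q * z) q = -thetaProd z q / z := by
  have h1 : qPochInf z⁻¹ q = (1 - z⁻¹) * qPochInf (z⁻¹ * q) q := (one_sub_mul_qPochInf hq _).symm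
  have h2 : q / (q * z) = z⁻¹ := by field_simp
  rw [thetaProd_eq hq z, thetaProd, h2, h1, mul_comm q z]
  field_simp
  ring

lemma thetaProd_sq_mul (hq : ‖q‖ < 1) (hq0 : q ≠ 0) (hz : z ≠ 0) :
    thetaProd (q ^ 2 * z) q = thetaProd z q / (q * z ^ 2) := by
  rw [show q ^ 2 * z = q * (q * z) by ring, thetaProd_mul hq hq0 (mul_ne_zero hq0 hz),
    thetaProd_mul hq hq0 hz]
  field_simp

/-- The two recurrences of `durfeeSum`, in either variable, meet at `durfeeSum z (1/(qz)) q`. -/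
lemma clearedRank_mul (hq : ‖q‖ < 1) (hq0 : q ≠ 0) (hz : z ≠ 0) :
    clearedRank (q * z) q = q * z ^ 2 * clearedRank z q + thetaProd z q * (q * z - z⁻¹) := by
  have h1 := durfeeSum_eq_add hq z (q * z)⁻¹
  have h2 := durfeeSum_eq_add hq (q * z)⁻¹ z
  have e1 : (q * z)⁻¹ * q = z⁻¹ := by field_simp
  have e2 : qPochInf (q * z)⁻¹ q = (1 - (q * z)⁻¹) * qPochInf z⁻¹ q := by
    rw [← e1, one_sub_mul_qPochInf hq]
  have e3 : qPochInf z⁻¹ q = (1 - z⁻¹) * qPochInf (z⁻¹ * q) q := (one_sub_mul_qPochInf hq _).symm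
  have e4 : qPochInf z q = (1 - z) * qPochInf (z * q) q := (one_sub_mul_qPochInf hq _).symm
  rw [e1, e3, e4] at h1
  rw [durfeeSum_comm, h1, e2, e3, durfeeSum_comm (q * z)⁻¹] at h2
  rw [clearedRank, clearedRank, thetaProd_eq hq z, mul_comm q z]
  rw [mul_comm q z] at h2
  generalize durfeeSum z z⁻¹ q = a at *
  generalize durfeeSum (z * q) (z * q)⁻¹ q = a' at *
  generalize qPochInf (z * q) q = u at *
  generalize qPochInf (z⁻¹ * q) q = v at *
  field_simp at h2 ⊢
  linear_combination -h2

lemma clearedRank_sq_mul (hq : ‖q‖ < 1) (hq0 : q ≠ 0) (hz : z ≠ 0) :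
    clearedRank (q ^ 2 * z) q = q ^ 4 * z ^ 4 * clearedRank z q
      + thetaProd z q * (q ^ 4 * z ^ 3 - q ^ 3 * z - q ^ 2 + 1 / (q * z ^ 2)) := by
  rw [show q ^ 2 * z = q * (q * z) by ring, clearedRank_mul hq hq0 (mul_ne_zero hq0 hz),
    clearedRank_mul hq hq0 hz, thetaProd_mul hq hq0 hz]
  field_simp
  ring

lemma differentiableAt_thetaProd (hq : ‖q‖ < 1) (hz : z ≠ 0) :
    DifferentiableAt ℂ (fun w => thetaProd w q) z := by
  have h := differentiable_qPochInf hq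
  have h2 : DifferentiableAt ℂ (fun w : ℂ => qPochInf (q / w) q) z :=
    (h (q / z)).comp z (f := fun w : ℂ => q / w) (by fun_prop (disch := exact hz))
  exact (h z).mul h2

lemma differentiableAt_clearedRank (hq : ‖q‖ < 1) (hz : z ≠ 0) :
    DifferentiableAt ℂ (fun w => clearedRank w q) z := by
  have hz' : 0 < ‖z‖ := norm_pos_iff.mpr hz
  have hball : ∀ w ∈ Metric.ball z (‖z‖ / 2), ‖z‖ / 2 ≤ ‖w‖ ∧ ‖w‖ ≤ 2 * ‖z‖ := by
    intro w hw
    rw [Metric.mem_ball, dist_eq_norm] at hw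
    have h1 := norm_sub_norm_le z w
    have h2 := norm_sub_norm_le w z
    rw [norm_sub_rev] at h1
    constructor <;> linarith
  have hne : ∀ w ∈ Metric.ball z (‖z‖ / 2), w ≠ 0 := fun w hw h0 => by
    have := (hball w hw).1
    rw [h0, norm_zero] at this
    linarith
  refine DifferentiableOn.differentiableAt (s := Metric.ball z (‖z‖ / 2)) ?_
    (Metric.ball_mem_nhds z (by positivity))
  refine differentiableOn_tsum_of_summable_norm
    ((summable_pow_mul_pow_sq (norm_nonneg q) hq 1).mul_right _) (fun n w hw => ?_)
    Metric.isOpen_ball (fun n w hw => norm_durfeeTerm_le hq (x := 1)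
      (R := max (2 * ‖z‖) (‖z‖ / 2)⁻¹) ?_ ?_ ?_ n)
  · have h := differentiable_qPochInf hq
    have hw0 := hne w hw
    have h1 : DifferentiableAt ℂ (fun w : ℂ => qPochInf (w * q ^ (n + 1)) q) w :=
      (h _).comp w (f := fun w : ℂ => w * q ^ (n + 1)) (by fun_prop)
    have h2 : DifferentiableAt ℂ (fun w : ℂ => qPochInf (w⁻¹ * q ^ (n + 1)) q) w :=
      (h _).comp w (f := fun w : ℂ => w⁻¹ * q ^ (n + 1)) (by fun_prop (disch := exact hw0))
    have h3 : DifferentiableAt ℂ (fun w : ℂ => (w * w⁻¹) ^ n * q ^ (n ^ 2)) w := by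
      fun_prop (disch := exact hw0)
    exact (h3.mul (h1.mul h2)).differentiableWithinAt
  · rw [mul_inv_cancel₀ (hne w hw), norm_one]
  · exact (hball w hw).2.trans (le_max_left _ _)
  · rw [norm_inv]
    exact (inv_anti₀ (by positivity) (hball w hw).1).trans (le_max_right _ _)

end theta

/-! ### Liouville's theorem on `ℂˣ / r^ℤ` -/

/-- A holomorphic function on `ℂˣ` that is invariant under `z ↦ r z`, where `0 < |r| < 1`, is
constant. -/
lemma eq_of_forall_mul_eq {f : ℂ → ℂ} {r : ℂ} (hr0 : r ≠ 0) (hr : ‖r‖ < 1)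
    (hf : ∀ z ≠ 0, DifferentiableAt ℂ f z) (hinv : ∀ z ≠ 0, f (r * z) = f z) {z w : ℂ}
    (hz : z ≠ 0) (hw : w ≠ 0) : f z = f w := by
  have hrpos : 0 < ‖r‖ := norm_pos_iff.mpr hr0
  have hnat : ∀ (n : ℕ), ∀ z ≠ 0, f (r ^ n * z) = f z := by
    intro n
    induction n with
    | zero => simp
    | succ n ih =>
      intro z hz
      rw [pow_succ', mul_assoc, hinv _ (mul_ne_zero (pow_ne_zero _ hr0) hz), ih z hz]
  have hint : ∀ (n : ℤ), ∀ z ≠ 0, f (r ^ n * z) = f z := by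
    intro n z hz
    obtain ⟨m, rfl | rfl⟩ := n.eq_nat_or_neg
    · simpa using hnat m z hz
    · have := hnat m (r ^ (-(m : ℤ)) * z) (mul_ne_zero (zpow_ne_zero _ hr0) hz)
      rw [← this, ← mul_assoc, zpow_neg, zpow_natCast, mul_inv_cancel₀ (pow_ne_zero _ hr0), one_mul]
  set K : Set ℂ := Metric.closedBall 0 ‖r‖⁻¹ \ Metric.ball 0 1 with hK
  have hKc : IsCompact K := (isCompact_closedBall _ _).diff Metric.isOpen_ball
  have hK0 : ∀ u ∈ K, u ≠ 0 := by
    rintro u ⟨-, hu⟩ rfl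
    simp at hu
  have hcont : ContinuousOn f K := fun u hu => (hf u (hK0 u hu)).continuousAt.continuousWithinAt
  have hg : Differentiable ℂ fun u => f (exp u) := fun u =>
    (hf _ (exp_ne_zero u)).comp u differentiable_exp.differentiableAt
  have hb : Bornology.IsBounded (Set.range fun u => f (exp u)) := by
    refine (hKc.image_of_continuousOn hcont).isBounded.subset ?_
    rintro _ ⟨u, rfl⟩
    obtain ⟨n, hn1, hn2⟩ := exists_mem_Ico_zpow (x := ‖exp u‖) (y := ‖r‖⁻¹)
      (norm_pos_iff.mpr (exp_ne_zero u)) ((one_lt_inv₀ hrpos).mpr hr)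
    have hpos : 0 < ‖r‖ ^ n := zpow_pos hrpos n
    rw [inv_zpow, inv_le_iff_one_le_mul₀' hpos] at hn1
    rw [zpow_add_one₀ (inv_ne_zero hrpos.ne'), inv_zpow, mul_comm, ← div_eq_mul_inv,
      lt_div_iff₀' hpos] at hn2
    refine ⟨r ^ n * exp u, ⟨?_, ?_⟩, hint n _ (exp_ne_zero u)⟩
    · rw [mem_closedBall_zero_iff, norm_mul, norm_zpow]
      exact hn2.le
    · rw [mem_ball_zero_iff, norm_mul, norm_zpow]
      exact not_lt.mpr hn1
  have := hg.apply_eq_apply_of_bounded hb (log z) (log w)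
  simpa [exp_log hz, exp_log hw] using this

/-! ### The combination of rank generating functions to the bases `q`, `iq` and `-iq` -/

section combination

variable {p q z c : ℂ}

/-- With `g(z; p)` the rank generating function divided by `1 - z`, this is
`g(z; p) - g(-z; p)` multiplied by `θ(z; p) θ(-z; p)`. -/
noncomputable def crossDiff (z p : ℂ) : ℂ :=
  clearedRank z p * thetaProd (-z) p - clearedRank (-z) p * thetaProd z p

/-- With `g(z; p)` the rank generating function divided by `1 - z`, this is
`g(z; p) + g(-z; p)` multiplied by `θ(z; p) θ(-z; p)`. -/
noncomputable def crossSum (z p : ℂ) : ℂ :=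
  clearedRank z p * thetaProd (-z) p + clearedRank (-z) p * thetaProd z p

lemma crossDiff_neg (z p : ℂ) : crossDiff (-z) p = -crossDiff z p := by
  simp only [crossDiff, neg_neg]; ring

lemma crossSum_neg (z p : ℂ) : crossSum (-z) p = crossSum z p := by
  simp only [crossSum, neg_neg]; ring

lemma crossDiff_sq_mul (hp : ‖p‖ < 1) (hp0 : p ≠ 0) (hz : z ≠ 0) :
    crossDiff (p ^ 2 * z) p = p ^ 3 * z ^ 2 * crossDiff z p
      + thetaProd (z ^ 2) (p ^ 2) * (2 * p ^ 3 * z - 2 * p ^ 2 / z) := by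
  have hz' : -z ≠ 0 := neg_ne_zero.mpr hz
  rw [← thetaProd_mul_neg hp, crossDiff, crossDiff, ← mul_neg, clearedRank_sq_mul hp hp0 hz,
    clearedRank_sq_mul hp hp0 hz', thetaProd_sq_mul hp hp0 hz, thetaProd_sq_mul hp hp0 hz']
  field_simp
  ring

lemma crossSum_sq_mul (hp : ‖p‖ < 1) (hp0 : p ≠ 0) (hz : z ≠ 0) :
    crossSum (p ^ 2 * z) p = p ^ 3 * z ^ 2 * crossSum z p
      + thetaProd (z ^ 2) (p ^ 2) * (2 / (p ^ 2 * z ^ 4) - 2 * p / z ^ 2) := by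
  have hz' : -z ≠ 0 := neg_ne_zero.mpr hz
  rw [← thetaProd_mul_neg hp, crossSum, crossSum, ← mul_neg, clearedRank_sq_mul hp hp0 hz,
    clearedRank_sq_mul hp hp0 hz', thetaProd_sq_mul hp hp0 hz, thetaProd_sq_mul hp hp0 hz']
  field_simp
  ring

/-- With `g(z; p)` the rank generating function divided by `1 - z`, this is
`g(cz; q) + (ic/2) (g(z; iq) - g(-z; iq)) - (1/2) (g(z; -iq) + g(-z; -iq))`
multiplied by `θ(cz; q) θ(z²; -q²)`. The poles of the functions to the bases `iq` and `-iq` all lie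
among the zeros of `θ(z²; -q²)`. -/
noncomputable def rankCombination (c z q : ℂ) : ℂ :=
  clearedRank (c * z) q * thetaProd (z ^ 2) (-q ^ 2)
    + thetaProd (c * z) q * (I * c / 2 * crossDiff z (I * q) - 1 / 2 * crossSum z (-I * q))

lemma norm_I_mul (q : ℂ) : ‖I * q‖ = ‖q‖ := by simp

lemma norm_neg_I_mul (q : ℂ) : ‖-I * q‖ = ‖q‖ := by simp

lemma I_mul_sq (q : ℂ) : (I * q) ^ 2 = -q ^ 2 := by rw [mul_pow, I_sq]; ring

lemma neg_I_mul_sq (q : ℂ) : (-I * q) ^ 2 = -q ^ 2 := by rw [mul_pow, neg_sq, I_sq]; ring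

/-- For `c² = i` the inhomogeneous terms of the five constituents cancel. -/
lemma rankCombination_sq_mul (hq : ‖q‖ < 1) (hq0 : q ≠ 0) (hc : c ^ 2 = I) (hz : z ≠ 0) :
    rankCombination c (q ^ 2 * z) q = q ^ 2 * rankCombination c z q := by
  have hc0 : c ≠ 0 := by rintro rfl; simp [eq_comm] at hc
  have hp : ‖I * q‖ < 1 := by rwa [norm_I_mul]
  have hp' : ‖-I * q‖ < 1 := by rwa [norm_neg_I_mul]
  have hp0 : I * q ≠ 0 := mul_ne_zero I_ne_zero hq0
  have hp0' : -I * q ≠ 0 := mul_ne_zero (neg_ne_zero.mpr I_ne_zero) hq0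
  have hD := crossDiff_sq_mul hp hp0 hz
  have hS := crossSum_sq_mul hp' hp0' hz
  rw [I_mul_sq, neg_mul, crossDiff_neg] at hD
  rw [neg_I_mul_sq, neg_mul, crossSum_neg] at hS
  have hT : thetaProd ((q ^ 2 * z) ^ 2) (-q ^ 2)
      = thetaProd (z ^ 2) (-q ^ 2) / (-q ^ 2 * (z ^ 2) ^ 2) := by
    have hq2 : ‖-q ^ 2‖ < 1 := by rw [norm_neg]; exact norm_sq_lt_one hq
    rw [← thetaProd_sq_mul hq2 (neg_ne_zero.mpr (pow_ne_zero 2 hq0)) (pow_ne_zero 2 hz)]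
    congr 1
    ring
  have hA := clearedRank_sq_mul hq hq0 (mul_ne_zero hc0 hz)
  have ht := thetaProd_sq_mul hq hq0 (mul_ne_zero hc0 hz)
  rw [rankCombination, rankCombination, mul_left_comm c, hT, hA, ht, hS,
    show crossDiff (q ^ 2 * z) (I * q) = -(-crossDiff (q ^ 2 * z) (I * q)) by ring, hD]
  have h3 : (I * q) ^ 3 = -I * q ^ 3 := by rw [mul_pow, I_pow_three]
  have h3' : (-I * q) ^ 3 = I * q ^ 3 := by rw [mul_pow, Odd.neg_pow (by decide), I_pow_three]; ring
  have hc4 : c ^ 4 = -1 := by rw [show c ^ 4 = (c ^ 2) ^ 2 by ring, hc, I_sq]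
  have hc3 : c ^ 3 = I * c := by rw [pow_succ, hc]
  rw [h3, h3', mul_pow c z, mul_pow c z, mul_pow c z, hc, hc3, hc4]
  have hinv : ∀ x : ℂ, x / (q * (I * z ^ 2)) = -I * x / (q * z ^ 2) := by
    intro x
    have hI0 : I ≠ 0 := I_ne_zero
    field_simp
    linear_combination x * I_sq
  rw [hinv, hinv]
  generalize thetaProd (z ^ 2) (-q ^ 2) = T
  generalize thetaProd (c * z) q = t
  generalize clearedRank (c * z) q = a
  generalize crossDiff z (I * q) = D
  generalize crossSum z (-I * q) = S
  have hI2 := I_sq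
  generalize I = i at *
  field_simp
  linear_combination (2 * q ^ 3 * z ^ 2 * t * T + 2 * q ^ 4 * z ^ 3 * t * c * T
    - 2 * q ^ 5 * z ^ 5 * t * c * i * T - q ^ 5 * z ^ 6 * t * c * i * D
    + q ^ 5 * z ^ 6 * t * S) * hI2

lemma differentiableAt_rankCombination (hq : ‖q‖ < 1) (hc0 : c ≠ 0) (hz : z ≠ 0) :
    DifferentiableAt ℂ (fun w => rankCombination c w q) z := by
  have hp : ‖I * q‖ < 1 := by rwa [norm_I_mul]
  have hp' : ‖-I * q‖ < 1 := by rwa [norm_neg_I_mul]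
  have hq2 : ‖-q ^ 2‖ < 1 := by rw [norm_neg]; exact norm_sq_lt_one hq
  have hcz := mul_ne_zero hc0 hz
  have hz' : -z ≠ 0 := neg_ne_zero.mpr hz
  have comp : ∀ {g h : ℂ → ℂ}, DifferentiableAt ℂ g (h z) → DifferentiableAt ℂ h z →
      DifferentiableAt ℂ (fun w => g (h w)) z := fun hg hh => hg.comp z hh
  have d1 := comp (h := fun w => c * w) (differentiableAt_clearedRank hq hcz) (by fun_prop)
  have d2 := comp (h := fun w => w ^ 2) (differentiableAt_thetaProd hq2 (pow_ne_zero 2 hz))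
    (by fun_prop)
  have d3 := comp (h := fun w => c * w) (differentiableAt_thetaProd hq hcz) (by fun_prop)
  have dA : ∀ p : ℂ, ‖p‖ < 1 → DifferentiableAt ℂ (fun w => clearedRank (-w) p) z := fun p hp =>
    comp (h := fun w => -w) (differentiableAt_clearedRank hp hz') (by fun_prop)
  have dT : ∀ p : ℂ, ‖p‖ < 1 → DifferentiableAt ℂ (fun w => thetaProd (-w) p) z := fun p hp =>
    comp (h := fun w => -w) (differentiableAt_thetaProd hp hz') (by fun_prop)
  have dD := ((differentiableAt_clearedRank hp hz).mul (dT _ hp)).sub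
    ((dA _ hp).mul (differentiableAt_thetaProd hp hz))
  have dS := ((differentiableAt_clearedRank hp' hz).mul (dT _ hp')).add
    ((dA _ hp').mul (differentiableAt_thetaProd hp' hz))
  exact (d1.mul d2).add (d3.mul ((dD.const_mul _).sub (dS.const_mul _)))

/-- `rankCombination c z q` is a constant multiple of `z`; the constant is found at `z = 1 / c`,
where only the first constituent survives and `durfeeSum_one_one` applies. -/
lemma rankCombination_eq (hq : ‖q‖ < 1) (hq0 : q ≠ 0) (hc : c ^ 2 = I) (hz : z ≠ 0) :
    rankCombination c z q = z * (c * (qPochInf q q * thetaProd (-I) (-q ^ 2))) := by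
  have hc0 : c ≠ 0 := by rintro rfl; simp [eq_comm] at hc
  have hconst := eq_of_forall_mul_eq (f := fun w => rankCombination c w q / w) (r := q ^ 2)
    (pow_ne_zero 2 hq0) (norm_sq_lt_one hq)
    (fun w hw => (differentiableAt_rankCombination hq hc0 hw).div differentiableAt_id hw)
    (fun w hw => by
      have := pow_ne_zero 2 hq0
      rw [rankCombination_sq_mul hq hq0 hc hw, mul_div_mul_left _ _ this]) hz (inv_ne_zero hc0)
  have hval : rankCombination c c⁻¹ q = qPochInf q q * thetaProd (-I) (-q ^ 2) := by
    rw [rankCombination, mul_inv_cancel₀ hc0, thetaProd_one hq, zero_mul, add_zero, clearedRank,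
      inv_one, durfeeSum_one_one hq, inv_pow, hc, inv_I]
  rw [hval, div_inv_eq_mul, div_eq_iff hz] at hconst
  rw [hconst]
  ring

end combination

/-! ### The mock theta functions as values of the rank generating function -/

section mock

variable {q w : ℂ} {a : ℝ}

lemma one_add_mul_pow_add_eq (hw : w ≠ 0) (ha : (a : ℂ) = -(w + w⁻¹)) (k : ℕ) :
    1 + (a : ℂ) * q ^ (k + 1) + q ^ (2 * (k + 1))
      = (1 - w * q * q ^ k) * (1 - w⁻¹ * q * q ^ k) := by
  rw [ha]
  field_simp
  ring

lemma prod_Icc_eq_qPoch_mul_qPoch (hw : w ≠ 0) (ha : (a : ℂ) = -(w + w⁻¹)) (n : ℕ) :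
    ∏ k ∈ Finset.Icc 1 n, (1 + (a : ℂ) * q ^ k + q ^ (2 * k))
      = qPoch (w * q) q n * qPoch (w⁻¹ * q) q n := by
  rw [qPoch, qPoch, ← Finset.prod_mul_distrib, ← Finset.Ico_add_one_right_eq_Icc,
    Finset.prod_Ico_eq_prod_range]
  refine Finset.prod_congr (by simp) fun k _ => ?_
  rw [add_comm 1 k, one_add_mul_pow_add_eq hw ha]

lemma ne_zero_of_norm_eq_one (hw : ‖w‖ = 1) : w ≠ 0 := by
  rintro rfl
  simp at hw

lemma qPochInf_mul_qPochInf_inv_ne_zero (hq : ‖q‖ < 1) (hw : ‖w‖ = 1) :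
    qPochInf (w * q) q * qPochInf (w⁻¹ * q) q ≠ 0 :=
  mul_ne_zero (qPochInf_mul_ne_zero hq hw.le)
    (qPochInf_mul_ne_zero hq (by rw [norm_inv, hw, inv_one]))

lemma durfeeTerm_eq_mul_fTerm (hq : ‖q‖ < 1) (hw : ‖w‖ = 1) (ha : (a : ℂ) = -(w + w⁻¹)) (n : ℕ) :
    durfeeTerm w w⁻¹ q n = qPochInf (w * q) q * qPochInf (w⁻¹ * q) q * fTerm a q n := by
  have hw0 := ne_zero_of_norm_eq_one hw
  have hne := qPochInf_mul_qPochInf_inv_ne_zero hq hw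
  rw [← qPoch_mul_qPochInf hq (w * q) n, ← qPoch_mul_qPochInf hq (w⁻¹ * q) n] at hne ⊢
  have h1 : qPoch (w * q) q n ≠ 0 := left_ne_zero_of_mul (left_ne_zero_of_mul hne)
  have h2 : qPoch (w⁻¹ * q) q n ≠ 0 := left_ne_zero_of_mul (right_ne_zero_of_mul hne)
  rw [durfeeTerm, fTerm, prod_Icc_eq_qPoch_mul_qPoch hw0 ha, mul_inv_cancel₀ hw0,
    mul_assoc w q, mul_assoc w⁻¹ q, ← pow_succ' q n]
  rw [mul_div_assoc']
  rw [eq_div_iff (mul_ne_zero h1 h2)]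
  ring

lemma summable_fTerm (hq : ‖q‖ < 1) (hw : ‖w‖ = 1) (ha : (a : ℂ) = -(w + w⁻¹)) :
    Summable (fTerm a q) :=
  (summable_mul_left_iff (qPochInf_mul_qPochInf_inv_ne_zero hq hw)).mp <|
    (summable_durfeeTerm hq w w⁻¹).congr (durfeeTerm_eq_mul_fTerm hq hw ha)

lemma clearedRank_eq_mul_f (hq : ‖q‖ < 1) (hw : ‖w‖ = 1) (ha : (a : ℂ) = -(w + w⁻¹)) :
    clearedRank w q = qPochInf (w * q) q * qPochInf (w⁻¹ * q) q * f a q := by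
  rw [clearedRank, durfeeSum, f, ← tsum_mul_left]
  exact tsum_congr (durfeeTerm_eq_mul_fTerm hq hw ha)

lemma hasProd_one_div_one_add (hq : ‖q‖ < 1) (hw : ‖w‖ = 1) (ha : (a : ℂ) = -(w + w⁻¹)) :
    HasProd (fun n : ℕ => 1 / (1 + (a : ℂ) * q ^ (n + 1) + q ^ (2 * (n + 1))))
      (qPochInf (w * q) q * qPochInf (w⁻¹ * q) q)⁻¹ := by
  have h := ((multipliable_qPochInf hq (w * q)).hasProd.mul
    (multipliable_qPochInf hq (w⁻¹ * q)).hasProd).inv₀ (qPochInf_mul_qPochInf_inv_ne_zero hq hw)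
  simp only [one_div, one_add_mul_pow_add_eq (ne_zero_of_norm_eq_one hw) ha]
  exact h

lemma phiTerm_eq_fTerm_zero (q : ℂ) : phiTerm q = fTerm 0 q := by
  funext n
  have h0 : ((0 : ℝ) : ℂ) = -(I + I⁻¹) := by simp
  rw [phiTerm, fTerm, prod_Icc_eq_qPoch_mul_qPoch I_ne_zero h0, qPoch, qPoch, qPoch,
    ← Finset.prod_mul_distrib]
  congr 1
  refine Finset.prod_congr rfl fun k _ => ?_
  rw [inv_I]
  linear_combination (q * q ^ k) ^ 2 * I_sq

lemma summable_phiTerm (hq : ‖q‖ < 1) : Summable (phiTerm q) := by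
  rw [phiTerm_eq_fTerm_zero]
  exact summable_fTerm hq norm_I (by simp)

lemma qPochInf_I_mul_qPochInf_neg_I (hq : ‖q‖ < 1) :
    qPochInf (I * q) q * qPochInf (-I * q) q = qPochInf (-q ^ 2) (q ^ 2) := by
  rw [neg_mul, qPochInf_mul_qPochInf_neg hq, I_mul_sq]

lemma clearedRank_I (hq : ‖q‖ < 1) : clearedRank I q = qPochInf (-q ^ 2) (q ^ 2) * phi q := by
  rw [clearedRank_eq_mul_f hq norm_I (a := 0) (by simp), inv_I, qPochInf_I_mul_qPochInf_neg_I hq,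
    phi_eq_f_zero]

lemma clearedRank_neg_I (q : ℂ) : clearedRank (-I) q = clearedRank I q := by
  rw [clearedRank, clearedRank, durfeeSum_comm, inv_neg, inv_I, neg_neg]

lemma thetaProd_I (hq : ‖q‖ < 1) : thetaProd I q = (1 - I) * qPochInf (-q ^ 2) (q ^ 2) := by
  rw [thetaProd_eq hq, inv_I, qPochInf_I_mul_qPochInf_neg_I hq]

lemma thetaProd_neg_I (hq : ‖q‖ < 1) : thetaProd (-I) q = (1 + I) * qPochInf (-q ^ 2) (q ^ 2) := by
  rw [thetaProd_eq hq, inv_neg, inv_I, neg_neg, mul_comm (qPochInf (-I * q) q),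
    qPochInf_I_mul_qPochInf_neg_I hq, sub_neg_eq_add]

lemma crossDiff_I (hq : ‖q‖ < 1) :
    crossDiff I q = 2 * I * qPochInf (-q ^ 2) (q ^ 2) ^ 2 * phi q := by
  rw [crossDiff, clearedRank_neg_I q, clearedRank_I hq, thetaProd_I hq, thetaProd_neg_I hq]
  ring

lemma crossSum_I (hq : ‖q‖ < 1) :
    crossSum I q = 2 * qPochInf (-q ^ 2) (q ^ 2) ^ 2 * phi q := by
  rw [crossSum, clearedRank_neg_I q, clearedRank_I hq, thetaProd_I hq, thetaProd_neg_I hq]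
  ring

end mock

/-! ### Gauss's product for `ψ` -/

section gauss

variable {q : ℂ}

lemma pow_ne_one_of_norm_lt_one (hq : ‖q‖ < 1) {n : ℕ} (hn : n ≠ 0) : q ^ n ≠ 1 := fun h => by
  have := pow_lt_one₀ (norm_nonneg q) hq hn
  rw [← norm_pow, h, norm_one] at this
  exact lt_irrefl _ this

lemma qPoch_odd_ne_zero (hq : ‖q‖ < 1) (n : ℕ) : qPoch q (q ^ 2) n ≠ 0 :=
  Finset.prod_ne_zero_iff.mpr fun k _ => by
    rw [← pow_mul, ← pow_succ', sub_ne_zero]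
    exact (pow_ne_one_of_norm_lt_one hq (by omega)).symm

lemma qPoch_even_ne_zero (hq : ‖q‖ < 1) (n : ℕ) : qPoch (q ^ 2) (q ^ 2) n ≠ 0 :=
  Finset.prod_ne_zero_iff.mpr fun k _ => by
    rw [← pow_succ', ← pow_mul, sub_ne_zero]
    exact (pow_ne_one_of_norm_lt_one hq (by omega)).symm

lemma qPoch_succ (a q : ℂ) (n : ℕ) : qPoch a q (n + 1) = qPoch a q n * (1 - a * q ^ n) :=
  Finset.prod_range_succ _ _

/-- Shanks's finite form of Gauss's identity, with
`P_n = (q²; q²)_n / (q; q²)_n`: `∑_{s<n} (P_n / P_s) q^{s(2n+1)} = ∑_{j<2n} q^{j(j+1)/2}`. -/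
lemma shanks_identity (hq : ‖q‖ < 1) (n : ℕ) :
    qPoch (q ^ 2) (q ^ 2) n / qPoch q (q ^ 2) n * ∑ s ∈ Finset.range n,
        qPoch q (q ^ 2) s / qPoch (q ^ 2) (q ^ 2) s * q ^ (s * (2 * n + 1))
      = ∑ j ∈ Finset.range (2 * n), q ^ ((j + 1).choose 2) := by
  induction n with
  | zero => simp
  | succ n ih =>
    have ho : ∀ k : ℕ, 1 - q * (q ^ 2) ^ k ≠ 0 := fun k => by
      rw [← pow_mul, ← pow_succ', sub_ne_zero]
      exact (pow_ne_one_of_norm_lt_one hq (by omega)).symm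
    have he : ∀ k : ℕ, 1 - q ^ 2 * (q ^ 2) ^ k ≠ 0 := fun k => by
      rw [← pow_succ', ← pow_mul, sub_ne_zero]
      exact (pow_ne_one_of_norm_lt_one hq (by omega)).symm
    -- Consecutive values of the left-hand side differ by a sum that telescopes in `s`.
    have htel : ∀ m : ℕ,
        qPoch (q ^ 2) (q ^ 2) (n + 1) / qPoch q (q ^ 2) (n + 1) * ∑ s ∈ Finset.range m,
            qPoch q (q ^ 2) s / qPoch (q ^ 2) (q ^ 2) s * q ^ (s * (2 * (n + 1) + 1))
          = qPoch (q ^ 2) (q ^ 2) n / qPoch q (q ^ 2) n * ∑ s ∈ Finset.range m,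
            qPoch q (q ^ 2) s / qPoch (q ^ 2) (q ^ 2) s * q ^ (s * (2 * n + 1))
          + qPoch (q ^ 2) (q ^ 2) n / qPoch q (q ^ 2) n
            * (qPoch q (q ^ 2) m / qPoch (q ^ 2) (q ^ 2) m)
            * (1 - q ^ (2 * m)) * q ^ (m * (2 * n + 1)) / (1 - q * (q ^ 2) ^ n) := by
      intro m
      induction m with
      | zero => simp
      | succ m ihm =>
        rw [Finset.sum_range_succ, Finset.sum_range_succ, mul_add, ihm, qPoch_succ q _ m,
          qPoch_succ (q ^ 2) _ m, qPoch_succ q _ n, qPoch_succ (q ^ 2) _ n]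
        have h1 := ho n
        have h2 := he m
        have h3 := qPoch_odd_ne_zero hq n
        have h4 := qPoch_even_ne_zero hq m
        generalize ∑ s ∈ Finset.range m,
          qPoch q (q ^ 2) s / qPoch (q ^ 2) (q ^ 2) s * q ^ (s * (2 * n + 1)) = T
        generalize qPoch (q ^ 2) (q ^ 2) n = En at *
        generalize qPoch q (q ^ 2) n = On at *
        generalize qPoch (q ^ 2) (q ^ 2) m = Em at *
        generalize qPoch q (q ^ 2) m = Om at *
        have e1 : q ^ ((m + 1) * (2 * n + 1)) = q ^ (m * (2 * n + 1)) * (q * (q ^ 2) ^ n) := by ring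
        have e2 : q ^ (m * (2 * (n + 1) + 1)) = q ^ (m * (2 * n + 1)) * (q ^ 2) ^ m := by ring
        have e3 : q ^ (2 * m) = (q ^ 2) ^ m := by ring
        have e4 : q ^ (2 * (m + 1)) = q ^ 2 * (q ^ 2) ^ m := by ring
        rw [e1, e2, e3, e4]
        generalize q ^ (m * (2 * n + 1)) = X at *
        generalize (q ^ 2) ^ m = Y at *
        generalize (q ^ 2) ^ n = Z at *
        obtain ⟨d, hd⟩ : ∃ d, d = 1 - q ^ 2 * Y := ⟨_, rfl⟩
        rw [← hd] at h2 ⊢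
        field_simp
        ring
    have h1 := ho n
    have h3 := qPoch_odd_ne_zero hq n
    have h4 := qPoch_even_ne_zero hq n
    rw [Finset.sum_range_succ, mul_add, htel n, ih, show 2 * (n + 1) = 2 * n + 1 + 1 by ring,
      Finset.sum_range_succ, Finset.sum_range_succ]
    have c1 : (2 * n + 1).choose 2 = n * (2 * n + 1) := by
      rw [Nat.choose_two_right, Nat.add_sub_cancel, show (2 * n + 1) * (2 * n)
        = n * (2 * n + 1) * 2 by ring, Nat.mul_div_cancel _ two_pos]
    have c2 : (2 * n + 1 + 1).choose 2 = n * (2 * n + 1) + (2 * n + 1) := by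
      rw [Nat.choose_two_right, Nat.add_sub_cancel, show (2 * n + 1 + 1) * (2 * n + 1)
        = (n * (2 * n + 1) + (2 * n + 1)) * 2 by ring, Nat.mul_div_cancel _ two_pos]
    rw [c1, c2, qPoch_succ, qPoch_succ]
    have e2 : q ^ (n * (2 * n + 1 + 1 + 1)) = q ^ (n * (2 * n + 1)) * (q ^ 2) ^ n := by ring
    have e3 : q ^ (2 * n) = (q ^ 2) ^ n := by ring
    have e4 : q ^ (n * (2 * n + 1) + (2 * n + 1)) = q ^ (n * (2 * n + 1)) * (q * (q ^ 2) ^ n) := by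
      ring
    rw [e2, e3, e4]
    generalize ∑ j ∈ Finset.range (2 * n), q ^ ((j + 1).choose 2) = T at *
    generalize qPoch (q ^ 2) (q ^ 2) n = En at *
    generalize qPoch q (q ^ 2) n = On at *
    generalize q ^ (n * (2 * n + 1)) = X at *
    generalize (q ^ 2) ^ n = Z at *
    obtain ⟨d, hd⟩ : ∃ d, d = 1 - q * Z := ⟨_, rfl⟩
    rw [← hd] at h1 ⊢
    field_simp
    rw [hd]
    ring

lemma tendsto_qPoch (hq : ‖q‖ < 1) (a : ℂ) :
    Tendsto (fun n => qPoch a q n) atTop (𝓝 (qPochInf a q)) :=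
  (multipliable_qPochInf hq a).hasProd.tendsto_prod_nat

lemma qPochInf_odd_ne_zero (hq : ‖q‖ < 1) : qPochInf q (q ^ 2) ≠ 0 :=
  qPochInf_ne_zero (norm_sq_lt_one hq) fun k => by
    rw [← pow_mul, ← pow_succ']
    exact pow_ne_one_of_norm_lt_one hq (by omega)

lemma qPochInf_self_ne_zero (hq : ‖q‖ < 1) : qPochInf q q ≠ 0 := by
  simpa using qPochInf_mul_ne_zero hq (a := 1) (by simp)

lemma summable_pow_choose_two (hq : ‖q‖ < 1) : Summable fun n : ℕ => q ^ ((n + 1).choose 2) := by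
  refine .of_norm_bounded (summable_geometric_of_lt_one (norm_nonneg q) hq) fun n => ?_
  rw [norm_pow]
  refine pow_le_pow_of_le_one (norm_nonneg q) hq.le ?_
  rw [Nat.choose_succ_left n 2 two_pos]
  simp

/-- Gauss's identity `ψ(q) = (q²; q²)_∞ / (q; q²)_∞`, the limit of `shanks_identity`. -/
lemma psi_eq (hq : ‖q‖ < 1) : psi q = qPochInf (q ^ 2) (q ^ 2) / qPochInf q (q ^ 2) := by
  have hq2 := norm_sq_lt_one hq
  have hP := (tendsto_qPoch hq2 (q ^ 2)).div (tendsto_qPoch hq2 q) (qPochInf_odd_ne_zero hq)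
  have hR := (tendsto_qPoch hq2 q).div (tendsto_qPoch hq2 (q ^ 2)) (qPochInf_self_ne_zero hq2)
  obtain ⟨C, hC⟩ := (Metric.isBounded_range_of_tendsto _ hR).exists_norm_le
  have hC' : ∀ s, ‖qPoch q (q ^ 2) s / qPoch (q ^ 2) (q ^ 2) s‖ ≤ C := fun s => hC _ ⟨s, rfl⟩
  have hC0 : 0 ≤ C := (norm_nonneg _).trans (hC' 0)
  -- Only the summand `s = 0` survives as `n → ∞`.
  have hsum : Tendsto (fun n : ℕ => ∑ s ∈ Finset.range n,
      qPoch q (q ^ 2) s / qPoch (q ^ 2) (q ^ 2) s * q ^ (s * (2 * n + 1))) atTop (𝓝 1) := by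
    have h := tendsto_tsum_of_dominated_convergence (𝓕 := atTop)
      (f := fun n s : ℕ => if s < n then
        qPoch q (q ^ 2) s / qPoch (q ^ 2) (q ^ 2) s * q ^ (s * (2 * n + 1)) else 0)
      (g := fun s : ℕ => if s = 0 then (1 : ℂ) else 0) (bound := fun s => C * ‖q‖ ^ s)
      ((summable_geometric_of_lt_one (norm_nonneg q) hq).mul_left C) ?_ (.of_forall ?_)
    · rw [tsum_ite_eq] at h
      refine h.congr fun n => ?_
      rw [tsum_eq_sum (s := Finset.range n) fun s hs => if_neg (by simpa using hs)]
      exact Finset.sum_congr rfl fun s hs => if_pos (Finset.mem_range.mp hs)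
    · intro s
      have hlt : ∀ᶠ n : ℕ in atTop, s < n := eventually_gt_atTop s
      rcases eq_or_ne s 0 with rfl | hs
      · refine tendsto_const_nhds.congr' (hlt.mono fun n hn => ?_)
        simp [hn, qPoch]
      · rw [if_neg hs]
        have hpow : Tendsto (fun n : ℕ => q ^ (s * (2 * n + 1))) atTop (𝓝 0) := by
          refine (tendsto_pow_atTop_nhds_zero_of_norm_lt_one hq).comp
            (tendsto_atTop_mono (fun n => ?_) tendsto_id)
          have : 1 ≤ s := Nat.one_le_iff_ne_zero.mpr hs
          simp only [id]
          nlinarith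
        have := hpow.const_mul (qPoch q (q ^ 2) s / qPoch (q ^ 2) (q ^ 2) s)
        rw [mul_zero] at this
        exact this.congr' (hlt.mono fun n hn => (if_pos hn).symm)
    · intro n s
      split_ifs
      · rw [norm_mul, norm_pow]
        exact mul_le_mul (hC' s) (pow_le_pow_of_le_one (norm_nonneg q) hq.le (by nlinarith))
          (by positivity) hC0
      · rw [norm_zero]; positivity
  have hlim := hP.mul hsum
  rw [mul_one] at hlim
  have hpsi : Tendsto (fun n : ℕ => ∑ j ∈ Finset.range (2 * n), q ^ ((j + 1).choose 2)) atTop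
      (𝓝 (psi q)) :=
    (summable_pow_choose_two hq).hasSum.tendsto_sum_nat.comp
      (tendsto_atTop_mono (fun n => by simp only [id]; omega) tendsto_id)
  exact tendsto_nhds_unique hpsi (hlim.congr fun n => shanks_identity hq n)

/-- The evaluation of the quotient of products that arises at `z = i`. -/
lemma qPochInf_mul_eq_psi_mul (hq : ‖q‖ < 1) :
    qPochInf q q * qPochInf (-q ^ 4) (q ^ 4)
      = qPochInf (q ^ 2) (-q ^ 2) ^ 2 * (psi (-q) * qPochInf (-q ^ 2) (q ^ 4)) := by
  have hq2 := norm_sq_lt_one hq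
  have hq4 : ‖q ^ 4‖ < 1 := by
    rw [norm_pow]; exact pow_lt_one₀ (norm_nonneg q) hq (by norm_num)
  have hm : ‖-q‖ < 1 := by rwa [norm_neg]
  have hm2 : ‖-q ^ 2‖ < 1 := by rwa [norm_neg]
  have e1 := qPochInf_even_mul_odd hq q
  have e2 := qPochInf_mul_qPochInf_neg hq2 q
  have e3 := qPochInf_even_mul_odd hm2 (q ^ 2)
  have e4 := qPochInf_even_mul_odd hq2 (-q ^ 2)
  have e5 := qPochInf_mul_qPochInf_neg hq2 (q ^ 2)
  have e6 := qPochInf_even_mul_odd hq2 (q ^ 2)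
  have e7 := psi_eq hm
  have n1 : qPochInf (-q) (q ^ 2) ≠ 0 := by
    have := qPochInf_odd_ne_zero hm
    rwa [neg_sq] at this
  have n2 := qPochInf_self_ne_zero hq4
  rw [neg_sq] at e7
  simp only [show (q ^ 2) ^ 2 = q ^ 4 by ring, show (-q ^ 2) ^ 2 = q ^ 4 by ring,
    show q ^ 2 * -q ^ 2 = -q ^ 4 by ring, show -q ^ 2 * q ^ 2 = -q ^ 4 by ring,
    show q ^ 2 * q ^ 2 = q ^ 4 by ring, show q * q = q ^ 2 by ring] at e1 e2 e3 e4 e5 e6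
  have euler : qPochInf (q ^ 2) (q ^ 4) * qPochInf (-q ^ 2) (q ^ 4) * qPochInf (-q ^ 4) (q ^ 4)
      = 1 := by
    rw [← e6, ← e4] at e5
    refine mul_right_cancel₀ n2 ?_
    linear_combination e5
  rw [e7, ← e3, ← e1, div_mul_eq_mul_div, mul_div_assoc', eq_div_iff n1]
  linear_combination qPochInf (q ^ 2) (q ^ 2) * qPochInf (-q ^ 4) (q ^ 4) * e2
    - qPochInf (q ^ 2) (q ^ 2) * qPochInf (-q ^ 4) (q ^ 4) * qPochInf (q ^ 2) (q ^ 4) * euler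

end gauss

/-! ### The identity -/

section identity

variable {q c : ℂ}

/-- Both evaluations of `rankCombination c i q`. -/
lemma phi_phi_f_identity (hq : ‖q‖ < 1) (hq0 : q ≠ 0) (hc : c ^ 2 = I) (hcn : ‖c * I‖ = 1)
    {a : ℝ} (ha : (a : ℂ) = -(c * I + (c * I)⁻¹)) :
    (1 - c * I) * (c * phi (I * q) + phi (-I * q)) - 2 * f a q
      = -(I * c * (1 + I)) * (psi (-q) * qPochInf (-q ^ 2) (q ^ 4))
        * (qPochInf (c * I * q) q * qPochInf ((c * I)⁻¹ * q) q)⁻¹ := by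
  have hp : ‖I * q‖ < 1 := by rwa [norm_I_mul]
  have hp' : ‖-I * q‖ < 1 := by rwa [norm_neg_I_mul]
  have hq2 : ‖-q ^ 2‖ < 1 := by rw [norm_neg]; exact norm_sq_lt_one hq
  have hmain := rankCombination_eq hq hq0 hc I_ne_zero
  have hE : qPochInf (q ^ 2) (-q ^ 2) ≠ 0 := by
    simpa using qPochInf_mul_ne_zero hq2 (a := -1) (by simp)
  have hW := qPochInf_mul_qPochInf_inv_ne_zero hq hcn
  have t1 : thetaProd (I ^ 2) (-q ^ 2) = 2 * qPochInf (q ^ 2) (-q ^ 2) ^ 2 := by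
    rw [I_sq, thetaProd_eq hq2, inv_neg, inv_one, neg_one_mul, neg_neg]; ring
  have t2 : thetaProd (-I) (-q ^ 2) = (1 + I) * qPochInf (-q ^ 4) (q ^ 4) := by
    rw [thetaProd_neg_I hq2, show (-q ^ 2) ^ 2 = q ^ 4 by ring]
  rw [rankCombination, crossDiff_I hp, crossSum_I hp', I_mul_sq, neg_I_mul_sq, neg_neg, t1, t2,
    thetaProd_eq hq, clearedRank_eq_mul_f hq hcn ha] at hmain
  have hG := qPochInf_mul_eq_psi_mul hq
  generalize qPochInf (c * I * q) q * qPochInf ((c * I)⁻¹ * q) q = W at *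
  generalize qPochInf (q ^ 2) (-q ^ 2) = E at *
  rw [← div_eq_mul_inv, eq_div_iff hW]
  refine mul_left_cancel₀ (pow_ne_zero 2 hE) ?_
  linear_combination -hmain - I * c * (1 + I) * hG
    + (1 - c * I) * W * c * E ^ 2 * phi (I * q) * I_sq

end identity

end MockTheta

/-- The summability and multipliability clauses record that every series and every infinite
product in the identity converges. -/
theorem mainTheorem3 (q : ℂ) (hq : ‖q‖ < 1) :
    Summable (MockTheta.phiTerm (Complex.I * q)) ∧
    Summable (MockTheta.phiTerm (-Complex.I * q)) ∧
    Summable (MockTheta.fTerm (√2) q) ∧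
    Summable (fun n : ℕ => (-q) ^ ((n + 1).choose 2)) ∧
    Multipliable (fun k : ℕ => 1 - (-q ^ 2) * (q ^ 4) ^ k) ∧
    Multipliable
      (fun n : ℕ => 1 / (1 + ((√2 : ℝ) : ℂ) * q ^ (n + 1) + q ^ (2 * (n + 1)))) ∧
    1 / 2 * (1 + Complex.exp (Real.pi * Complex.I / 4)) * MockTheta.phi (Complex.I * q)
        + 1 / 2 * (1 + Complex.exp (-(Real.pi * Complex.I / 4))) * MockTheta.phi (-Complex.I * q)
        - MockTheta.f (√2) q
      = 1 / ((√2 : ℝ) : ℂ) * MockTheta.psi (-q) * MockTheta.qPochInf (-q ^ 2) (q ^ 4)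
        * ∏' n : ℕ, 1 / (1 + ((√2 : ℝ) : ℂ) * q ^ (n + 1) + q ^ (2 * (n + 1))) := by
  have hq4 : ‖q ^ 4‖ < 1 := by
    rw [norm_pow]; exact pow_lt_one₀ (norm_nonneg q) hq (by norm_num)
  set c : ℂ := Complex.exp (Real.pi * Complex.I / 4) with hc_def
  have hs : ((√2 : ℝ) : ℂ) ^ 2 = 2 := by
    rw [← Complex.ofReal_pow, Real.sq_sqrt (by norm_num)]; norm_num
  have hs0 : ((√2 : ℝ) : ℂ) ≠ 0 := fun h => by simp [h] at hs
  have hc_val : c = (√2 : ℝ) / 2 * (1 + Complex.I) := by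
    rw [hc_def, show (Real.pi : ℂ) * Complex.I / 4 = ((Real.pi / 4 : ℝ) : ℂ) * Complex.I by
      push_cast; ring, Complex.exp_mul_I, ← Complex.ofReal_cos, ← Complex.ofReal_sin,
      Real.cos_pi_div_four, Real.sin_pi_div_four]
    push_cast
    ring
  have hc : c ^ 2 = Complex.I := by
    rw [hc_val]
    linear_combination (1 + Complex.I) ^ 2 / 4 * hs + 1 / 2 * Complex.I_sq
  have hcn : ‖c * Complex.I‖ = 1 := by
    rw [norm_mul, Complex.norm_I, mul_one, hc_def, show (Real.pi : ℂ) * Complex.I / 4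
      = ((Real.pi / 4 : ℝ) : ℂ) * Complex.I by push_cast; ring, Complex.norm_exp_ofReal_mul_I]
  have hcI : c * (-(c * Complex.I)) = 1 := by
    linear_combination -Complex.I * hc - Complex.I_sq
  have hc_inv : Complex.exp (-(Real.pi * Complex.I / 4)) = -(c * Complex.I) := by
    rw [Complex.exp_neg, ← hc_def]
    exact inv_eq_of_mul_eq_one_right hcI
  have hcI_inv : (c * Complex.I)⁻¹ = -c := inv_eq_of_mul_eq_one_right (by linear_combination hcI)
  have ha : ((√2 : ℝ) : ℂ) = -(c * Complex.I + (c * Complex.I)⁻¹) := by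
    rw [hcI_inv, hc_val]
    linear_combination ((√2 : ℝ) / 2 : ℂ) * Complex.I_sq
  have hprod := MockTheta.hasProd_one_div_one_add hq hcn ha
  refine ⟨MockTheta.summable_phiTerm (by rwa [MockTheta.norm_I_mul]),
    MockTheta.summable_phiTerm (by rwa [MockTheta.norm_neg_I_mul]),
    MockTheta.summable_fTerm hq hcn ha, MockTheta.summable_pow_choose_two (by rwa [norm_neg]),
    MockTheta.multipliable_qPochInf hq4 _, hprod.multipliable, ?_⟩
  rw [hc_inv]
  rcases eq_or_ne q 0 with rfl | hq0
  · have hphi : MockTheta.phi 0 = 1 := by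
      rw [MockTheta.phi, tsum_eq_single 0 fun n hn => by simp [MockTheta.phiTerm, hn]]
      simp [MockTheta.phiTerm, MockTheta.qPoch]
    have hf : MockTheta.f (√2) 0 = 1 := by
      rw [MockTheta.f, tsum_eq_single 0 fun n hn => by simp [MockTheta.fTerm, hn]]
      simp [MockTheta.fTerm]
    have hpsi : MockTheta.psi 0 = 1 := by
      rw [MockTheta.psi, tsum_eq_single 0 fun n hn => by
        rw [zero_pow (Nat.choose_pos (by omega)).ne']]
      simp
    simp only [mul_zero, neg_zero, hphi, hf, hpsi, ne_eq, OfNat.ofNat_ne_zero, not_false_eq_true,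
      zero_pow, MockTheta.qPochInf_zero, Nat.add_eq_zero_iff, one_ne_zero, and_false, mul_one,
      add_zero, div_one, tprod_one, hc_val, mul_eq_zero, or_self]
    field_simp
    linear_combination (1 - Complex.I ^ 2) * hs - 2 * Complex.I_sq
  · have h := MockTheta.phi_phi_f_identity hq hq0 hc hcn ha
    rw [hprod.tprod_eq]
    have hk : -(Complex.I * c * (1 + Complex.I)) = 2 * (1 / ((√2 : ℝ) : ℂ)) := by
      rw [hc_val]
      field_simp
      linear_combination (-Complex.I * (1 + Complex.I) ^ 2) * hs
        - (4 + 2 * Complex.I) * Complex.I_sq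
    rw [hk] at h
    linear_combination h / 2 - MockTheta.phi (Complex.I * q) / 2 * hcI
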